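/- Let $d\ge 0$, let $P_1,\dots,P_r\subset\mathbb{R}^d$ be convex polytopes (convex hulls of finite nonempty point sets), each of dimension $d$, and let $P=P_1+\cdots+P_r$ be their Minkowski sum. Every nonempty face $F$ of $P$ decomposes uniquely as $F=F_1+\cdots+F_r$ with $F_i$ a face of $P_i$; the decomposition is called exact if $\dim F=\dim F_1+\cdots+\dim F_r$. Suppose that $P_1,\dots,P_r$ are relatively in general position, that is, every facet of $P$ (face of dimension $\dim P-1$) has an exact decomposition. Write $f_k(Q)$ for the number of $k$-dimensional faces of a polytope $Q$, and put $f^\delta_k(P)=f_k(P)-\bigl(f_k(P_1)+\cdots+f_k(P_r)\bigr)$. Then $$\sum_{k=0}^{d-1}(-1)^k\,k\,f^\delta_k(P)=0 .$$ -/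

import Mathlib

open scoped Pointwise

section MinkowskiSums

variable {E : Type*} [NormedAddCommGroup E] [NormedSpace ℝ E]

/-- A (convex) polytope: the convex hull of a finite nonempty set of points. -/
def IsPolytope (P : Set E) : Prop :=
  ∃ s : Finset E, s.Nonempty ∧ P = convexHull ℝ (s : Set E)

/-- The dimension of a nonempty set: the dimension of its affine hull. -/
noncomputable def setDim (S : Set E) : ℕ :=
  Module.finrank ℝ (vectorSpan ℝ S)

/-- `F` is a nonempty face of `P`: a nonempty subset of `P` consisting of all points of `P` at
which some linear functional attains its maximum over `P`. The whole of `P` is one of its faces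
(take the zero functional). -/
def IsFace (P F : Set E) : Prop :=
  F.Nonempty ∧ IsExposed ℝ P F

/-- `F` is a facet of `P`: a face of dimension `dim P - 1`. -/
def IsFacet (P F : Set E) : Prop :=
  IsFace P F ∧ setDim F + 1 = setDim P

/-- `f_k(P)`, the number of `k`-dimensional faces of `P` (for `k ≥ 0`). -/
noncomputable def fNumber (k : ℕ) (P : Set E) : ℕ :=
  {F : Set E | IsFace P F ∧ setDim F = k}.ncard

/-- `F = F_1 + ⋯ + F_r`, where `F_i` is a face of `P_i` for every `i`. -/
def IsDecomposition {r : ℕ} (P : Fin r → Set E) (F : Set E) (G : Fin r → Set E) : Prop :=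
  (∀ i, IsFace (P i) (G i)) ∧ F = ∑ i, G i

/-- `F` has an exact decomposition in the Minkowski sum of the `P_i`: the dimension of `F` is the
sum of the dimensions of the faces into which `F` decomposes. -/
def HasExactDecomposition {r : ℕ} (P : Fin r → Set E) (F : Set E) : Prop :=
  ∃ G : Fin r → Set E, IsDecomposition P F G ∧ setDim F = ∑ i, setDim (G i)

/-- The `P_i` are relatively in general position: every facet of their Minkowski sum has an exact
decomposition. -/
def RelativelyInGeneralPosition {r : ℕ} (P : Fin r → Set E) : Prop :=
  ∀ F : Set E, IsFacet (∑ i, P i) F → HasExactDecomposition P F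

/-- `f^δ_k(F) = f_k(F) - (f_k(F_1) + ⋯ + f_k(F_r))` for a set `F` that decomposes into
`F_1 + ⋯ + F_r`. -/
noncomputable def fDelta {r : ℕ} (k : ℕ) (F : Set E) (G : Fin r → Set E) : ℤ :=
  (fNumber k F : ℤ) - ∑ i, (fNumber k (G i) : ℤ)

end MinkowskiSums

/-! For a vector `u`, the face of the sum maximising `⟪u, ·⟫` is the sum of the faces of the `P i`
maximising it, and it determines each of them. Write `F_j` for the component of `F` in `P j`.

General position gives `dim F = ∑ j, dim F_j` for every proper face `F`, not only for facets: `F`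
lies in a facet, the direction spaces of that facet's components are independent, and subspaces of
independent subspaces are independent (`RelativelyInGeneralPosition.setDim_faceIn_sum`). So the sum
of `(-1)^(dim F) * dim F` over proper faces splits into sums of `(-1)^(dim F) * dim F_j`, one for
each `j`.

In the `j`-th sum, group the faces by `G = F_j`. The relatively open normal cone of `G` in `P j` is
the disjoint union of the normal cones of all `F` with `F_j = G`. The cone of `F` has dimension `d -
dim F`, and `(-1)^dim` is additive over finite partitions of a relatively open convex set into such
sets (`sum_relOpenEuler_eq_of_partition`). Hence the signs in the group add up to `(-1)^(dim G)`
(`sum_neg_one_pow_setDim_of_componentFace`), and the `j`-th sum is the same expression for `P j`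
alone. -/

open Filter Topology

/-! ### Relatively open convex sets and their slices -/

section EulerRelation

variable {V : Type*} [AddCommGroup V] [Module ℝ V]

/-- A convex set that is relatively open: every segment in it can be prolonged beyond its ends. -/
def IsRelOpenConvex (C : Set V) : Prop :=
  Convex ℝ C ∧ ∀ x ∈ C, ∀ y ∈ C, ∃ ε : ℝ, 0 < ε ∧ x + ε • (x - y) ∈ C

open Classical in
/-- The Euler characteristic with compact support of a relatively open convex set. -/
noncomputable def relOpenEuler (C : Set V) : ℤ :=
  if C.Nonempty then (-1) ^ Module.finrank ℝ (vectorSpan ℝ C) else 0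

theorem relOpenEuler_of_nonempty {C : Set V} (h : C.Nonempty) :
    relOpenEuler C = (-1) ^ Module.finrank ℝ (vectorSpan ℝ C) := by
  simp [relOpenEuler, h]

@[simp]
theorem relOpenEuler_singleton (a : V) : relOpenEuler {a} = 1 := by
  rw [relOpenEuler_of_nonempty (Set.singleton_nonempty a), vectorSpan_singleton, finrank_bot,
    pow_zero]

@[simp]
theorem relOpenEuler_empty : relOpenEuler (∅ : Set V) = 0 := by
  simp [relOpenEuler]

theorem relOpenEuler_sq {C : Set V} (h : C.Nonempty) :
    relOpenEuler C * relOpenEuler C = 1 := by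
  rw [relOpenEuler_of_nonempty h, ← mul_pow]; simp

theorem Convex.add_smul_mem_of_le {C : Set V} (hC : Convex ℝ C) {x v : V} {ε δ : ℝ} (hx : x ∈ C)
    (h : x + ε • v ∈ C) (hδ : 0 ≤ δ) (hε : 0 < ε) (hle : δ ≤ ε) : x + δ • v ∈ C := by
  have h1 := hC.add_smul_mem hx h (t := δ / ε) ⟨by positivity, by rw [div_le_one hε]; exact hle⟩
  rwa [smul_smul, div_mul_cancel₀ _ hε.ne'] at h1

/-- The directions in which `x` can move inside `C` form a subspace: prolongation gives negatives,
midpoints give sums. It contains all differences `y - x`. -/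
theorem IsRelOpenConvex.exists_add_smul_mem {C : Set V} (hC : IsRelOpenConvex C) {x v : V}
    (hx : x ∈ C) (hv : v ∈ vectorSpan ℝ C) : ∃ ε : ℝ, 0 < ε ∧ x + ε • v ∈ C := by
  rw [vectorSpan_eq_span_vsub_set_right ℝ hx] at hv
  have hneg : ∀ w : V, (∃ ε : ℝ, 0 < ε ∧ x + ε • w ∈ C) →
      ∃ ε : ℝ, 0 < ε ∧ x + ε • (-w) ∈ C := by
    rintro w ⟨ε, hε, hw⟩
    obtain ⟨δ, hδ, h⟩ := hC.2 x hx _ hw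
    refine ⟨δ * ε, by positivity, ?_⟩
    convert h using 2
    simp [smul_smul]
  induction hv using Submodule.span_induction with
  | mem v hv =>
    obtain ⟨y, hy, rfl⟩ := hv
    exact ⟨1, one_pos, by simpa using hy⟩
  | zero => exact ⟨1, one_pos, by simpa using hx⟩
  | add v w _ _ ihv ihw =>
    obtain ⟨ε, hε, h1⟩ := ihv
    obtain ⟨δ, hδ, h2⟩ := ihw
    have hm : 0 < min ε δ := lt_min hε hδ
    have h1' := hC.1.add_smul_mem_of_le hx h1 hm.le hε (min_le_left _ _)
    have h2' := hC.1.add_smul_mem_of_le hx h2 hm.le hδ (min_le_right _ _)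
    refine ⟨min ε δ / 2, by positivity, ?_⟩
    convert hC.1 h1' h2' (by norm_num : (0 : ℝ) ≤ 1 / 2)
      (by norm_num : (0 : ℝ) ≤ 1 / 2) (by norm_num) using 1
    module
  | smul a v _ ih =>
    rcases lt_trichotomy a 0 with ha | ha | ha
    · obtain ⟨ε, hε, h⟩ := hneg v ih
      refine ⟨ε / (-a), div_pos hε (by linarith), ?_⟩
      convert h using 2
      rw [smul_smul, smul_neg, ← neg_smul]
      congr 1
      rw [div_neg, neg_mul, div_mul_cancel₀ _ ha.ne]
    · exact ⟨1, one_pos, by simpa [ha] using hx⟩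
    · obtain ⟨ε, hε, h⟩ := ih
      refine ⟨ε / a, by positivity, ?_⟩
      rwa [smul_smul, div_mul_cancel₀ _ ha.ne']

theorem IsRelOpenConvex.image {C : Set V} (hC : IsRelOpenConvex C) {U : Type*} [AddCommGroup U]
    [Module ℝ U] (φ : V →ₗ[ℝ] U) : IsRelOpenConvex (φ '' C) := by
  refine ⟨hC.1.linear_image φ, ?_⟩
  rintro _ ⟨x, hx, rfl⟩ _ ⟨y, hy, rfl⟩
  obtain ⟨ε, hε, h⟩ := hC.2 x hx y hy
  exact ⟨ε, hε, _, h, by simp⟩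

theorem IsRelOpenConvex.slice {C : Set V} (hC : IsRelOpenConvex C) (φ : V →ₗ[ℝ] ℝ) (t : ℝ) :
    IsRelOpenConvex (C ∩ {x | φ x = t}) := by
  refine ⟨hC.1.inter (convex_hyperplane φ.isLinear t), ?_⟩
  rintro x ⟨hx, hxt⟩ y ⟨hy, hyt⟩
  obtain ⟨ε, hε, h⟩ := hC.2 x hx y hy
  simp only [Set.mem_ofPred_eq] at hxt hyt
  exact ⟨ε, hε, h, by simp [hxt, hyt]⟩

theorem vectorSpan_linear_image {U : Type*} [AddCommGroup U] [Module ℝ U] (C : Set V)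
    (φ : V →ₗ[ℝ] U) : vectorSpan ℝ (φ '' C) = (vectorSpan ℝ C).map φ := by
  have := AffineMap.map_vectorSpan (s := C) φ.toAffineMap
  simpa using this.symm

theorem IsRelOpenConvex.vectorSpan_slice {C : Set V} (hC : IsRelOpenConvex C) (φ : V →ₗ[ℝ] ℝ)
    {t : ℝ} (hne : (C ∩ {x | φ x = t}).Nonempty) :
    vectorSpan ℝ (C ∩ {x | φ x = t}) = vectorSpan ℝ C ⊓ LinearMap.ker φ := by
  obtain ⟨x, hx, hxt⟩ := hne
  simp only [Set.mem_ofPred_eq] at hxt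
  apply le_antisymm
  · refine le_inf (vectorSpan_mono ℝ Set.inter_subset_left) ?_
    rw [vectorSpan_def, Submodule.span_le]
    rintro _ ⟨a, ⟨-, ha⟩, b, ⟨-, hb⟩, rfl⟩
    simp only [Set.mem_ofPred_eq] at ha hb
    simp [ha, hb]
  · rintro v ⟨hv, hv0⟩
    obtain ⟨ε, hε, h⟩ := hC.exists_add_smul_mem hx hv
    have h1 : x + ε • v ∈ C ∩ {x | φ x = t} := by
      refine ⟨h, ?_⟩
      have : φ v = 0 := hv0
      simp [this, hxt]
    have h2 := vsub_mem_vectorSpan ℝ h1 (⟨hx, hxt⟩ : x ∈ C ∩ {x | φ x = t})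
    simp only [vsub_eq_sub, add_sub_cancel_left] at h2
    exact (Submodule.smul_mem_iff _ hε.ne').1 h2

theorem finrank_map_add_finrank_inf_ker [FiniteDimensional ℝ V] (W : Submodule ℝ V)
    (φ : V →ₗ[ℝ] ℝ) :
    Module.finrank ℝ (W.map φ) + Module.finrank ℝ ↥(W ⊓ LinearMap.ker φ) = Module.finrank ℝ W := by
  rw [← LinearMap.finrank_range_add_finrank_ker (φ.domRestrict W), LinearMap.range_domRestrict,
    LinearMap.ker_domRestrict, ← Submodule.map_comap_subtype]
  congr 1
  exact ((Submodule.equivMapOfInjective W.subtype W.subtype_injective _).finrank_eq).symm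

-- A nonempty slice loses exactly `dim φ(C)`, which is 0 or 1, so its sign is the product of those
-- of `C` and `φ '' C`. This is the Fubini step of the induction on dimension.
open Classical in
theorem IsRelOpenConvex.relOpenEuler_slice [FiniteDimensional ℝ V] {C : Set V}
    (hC : IsRelOpenConvex C) (φ : V →ₗ[ℝ] ℝ) (t : ℝ) :
    relOpenEuler (C ∩ {x | φ x = t}) =
      relOpenEuler C * relOpenEuler (φ '' C) * (if t ∈ φ '' C then 1 else 0) := by
  by_cases hne : (C ∩ {x | φ x = t}).Nonempty
  · have hne' := hne
    obtain ⟨x, hx, hxt⟩ := hne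
    have hCn : C.Nonempty := ⟨x, hx⟩
    rw [if_pos ⟨x, hx, hxt⟩, mul_one, relOpenEuler_of_nonempty hne', relOpenEuler_of_nonempty hCn,
      relOpenEuler_of_nonempty (hCn.image _), hC.vectorSpan_slice φ hne', vectorSpan_linear_image]
    rw [← finrank_map_add_finrank_inf_ker (vectorSpan ℝ C) φ, pow_add, mul_right_comm, ← mul_pow]
    simp
  · rw [if_neg]
    · simp [relOpenEuler, hne]
    · rintro ⟨x, hx, hxt⟩
      exact hne ⟨x, hx, hxt⟩

end EulerRelation

/-! ### Euler's relation on the real line -/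

section Line

theorem Set.OrdConnected.eventually_or_nhdsGT {I : Set ℝ} (hI : I.OrdConnected) (x : ℝ) :
    (∀ᶠ t in 𝓝[>] x, t ∈ I) ∨ ∀ᶠ t in 𝓝[>] x, t ∉ I := by
  by_cases h : ∃ᶠ t in 𝓝[>] x, t ∈ I
  · left
    obtain ⟨b, hbI, hb⟩ := (h.and_eventually self_mem_nhdsWithin).exists
    filter_upwards [Ioo_mem_nhdsGT hb] with t ht
    obtain ⟨a, haI, ha⟩ := (h.and_eventually (Ioo_mem_nhdsGT ht.1)).exists
    exact hI.out haI hbI ⟨ha.2.le, ht.2.le⟩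
  · right
    exact not_frequently.1 h

theorem Set.OrdConnected.eventually_or_atBot {I : Set ℝ} (hI : I.OrdConnected) :
    (∀ᶠ t in atBot, t ∈ I) ∨ ∀ᶠ t in atBot, t ∉ I := by
  by_cases h : ∃ᶠ t in atBot, t ∈ I
  · left
    obtain ⟨b, hbI⟩ := h.exists
    filter_upwards [Iic_mem_atBot b] with t ht
    obtain ⟨a, haI, ha⟩ := (h.and_eventually (Iic_mem_atBot t)).exists
    exact hI.out haI hbI ⟨ha, ht⟩
  · right
    exact not_frequently.1 h

open Classical in
/-- The jump of the indicator function of `I` immediately to the right of `x`. -/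
noncomputable def rightJump (I : Set ℝ) (x : ℝ) : ℤ :=
  (if x ∈ I then 1 else 0) - (if ∀ᶠ t in 𝓝[>] x, t ∈ I then 1 else 0)

open Classical in
/-- The value of the indicator function of `I` near `-∞`. -/
noncomputable def valueAtBot (I : Set ℝ) : ℤ :=
  if ∀ᶠ t in atBot, t ∈ I then 1 else 0

theorem IsRelOpenConvex.exists_gt_lt {I : Set ℝ} (hI : IsRelOpenConvex I)
    (hI' : I.Nontrivial) {x : ℝ} (hx : x ∈ I) : (∃ y ∈ I, x < y) ∧ ∃ y ∈ I, y < x := by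
  obtain ⟨y, hy, hxy⟩ := hI'.exists_ne x
  obtain ⟨ε, hε, h⟩ := hI.2 x hx y hy
  simp only [smul_eq_mul] at h
  rcases hxy.lt_or_gt with h1 | h1
  · exact ⟨⟨_, h, by nlinarith⟩, y, hy, h1⟩
  · exact ⟨⟨y, hy, h1⟩, _, h, by nlinarith⟩

/-- The Euler characteristic of a convex relatively open set of reals is the sum of its jumps. -/
theorem IsRelOpenConvex.exists_sum_rightJump {I : Set ℝ} (hI : IsRelOpenConvex I) :
    ∃ S : Finset ℝ, ∀ T : Finset ℝ, S ⊆ T →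
      ∑ x ∈ T, rightJump I x - valueAtBot I = relOpenEuler I := by
  have hoc := hI.1.ordConnected
  rcases I.eq_empty_or_nonempty with rfl | hne
  · have : ∀ (l : Filter ℝ) [l.NeBot], ¬ ∀ᶠ t in l, t ∈ (∅ : Set ℝ) := fun l _ h => by
      obtain ⟨t, ht⟩ := h.exists
      exact ht
    exact ⟨∅, fun T _ => by simp only [rightJump, valueAtBot, if_neg (this _)]; simp⟩
  rcases I.subsingleton_or_nontrivial with hs | hnt
  · obtain ⟨a, rfl⟩ := hs.eq_empty_or_singleton.resolve_left hne.ne_empty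
    refine ⟨{a}, fun T hT => ?_⟩
    have hj : ∀ x, rightJump {a} x = if x = a then 1 else 0 := by
      intro x
      have : ¬ ∀ᶠ t in 𝓝[>] x, t ∈ ({a} : Set ℝ) := by
        intro h
        obtain ⟨b, hb, hxb⟩ := (h.and self_mem_nhdsWithin).exists
        obtain ⟨c, hc, hxc⟩ := (h.and (Ioo_mem_nhdsGT hxb)).exists
        simp only [Set.mem_singleton_iff] at hb hc
        exact hxc.2.ne (hc.trans hb.symm)
      simp only [rightJump, if_neg this, sub_zero, Set.mem_singleton_iff]
    have hb : valueAtBot {a} = 0 := by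
      have : ¬ ∀ᶠ t in atBot, t ∈ ({a} : Set ℝ) := by
        intro h
        obtain ⟨b, hb, hxb⟩ := (h.and (Iio_mem_atBot a)).exists
        exact hxb.ne hb
      simp only [valueAtBot, if_neg this]
    have ha : a ∈ T := hT (by simp)
    simp [hj, hb, ha]
  -- What remains is an open interval. Only its lower end counts: a jump of `-1` if it is finite,
  -- the value 1 near `-∞` otherwise. At a finite upper end both terms of the jump are 0.
  have hdim : relOpenEuler I = -1 := by
    obtain ⟨a, ha, b, hb, hab⟩ := hnt
    have h1 : vectorSpan ℝ I = ⊤ := by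
      have := vsub_mem_vectorSpan ℝ ha hb
      rw [Ideal.eq_top_iff_one (vectorSpan ℝ I)]
      have h2 := (vectorSpan ℝ I).smul_mem (a - b)⁻¹ this
      simpa [sub_ne_zero.2 hab] using h2
    rw [relOpenEuler_of_nonempty hne, h1]
    simp
  rw [hdim]
  have hright : ∀ x ∈ I, ∀ᶠ t in 𝓝[>] x, t ∈ I := by
    intro x hx
    obtain ⟨y, hy, hxy⟩ := (hI.exists_gt_lt hnt hx).1
    filter_upwards [Ioo_mem_nhdsGT hxy] with t ht
    exact hoc.out hx hy ⟨ht.1.le, ht.2.le⟩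
  by_cases hbdd : BddBelow I
  · have hglb := isGLB_csInf hne hbdd
    set a := sInf I
    have haI : a ∉ I := fun h => by
      obtain ⟨y, hy, hya⟩ := (hI.exists_gt_lt hnt h).2
      exact absurd (hglb.1 hy) (not_le.2 hya)
    have hb : valueAtBot I = 0 := by
      have : ¬ ∀ᶠ t in atBot, t ∈ I := by
        intro h
        obtain ⟨b, hb, hxb⟩ := (h.and (Iio_mem_atBot a)).exists
        exact absurd (hglb.1 hb) (not_le.2 hxb)
      simp only [valueAtBot, if_neg this]
    have hra : ∀ᶠ t in 𝓝[>] a, t ∈ I := by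
      obtain ⟨b, hb⟩ := hne
      have hab : a < b := lt_of_le_of_ne (hglb.1 hb) (fun h => haI (h ▸ hb))
      filter_upwards [Ioo_mem_nhdsGT hab] with t ht
      obtain ⟨c, hc, hct⟩ := (isGLB_lt_iff hglb).1 ht.1
      exact hoc.out hc hb ⟨hct.le, ht.2.le⟩
    have hj : ∀ x, rightJump I x = if x = a then -1 else 0 := by
      intro x
      unfold rightJump
      by_cases hx : x ∈ I
      · have : x ≠ a := fun h => haI (h ▸ hx)
        simp [hx, hright x hx, this]
      by_cases hxa : x = a
      · subst hxa
        simp [hx, hra]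
      · have : ¬ ∀ᶠ t in 𝓝[>] x, t ∈ I := by
          intro h
          rcases lt_or_gt_of_ne hxa with h1 | h1
          · obtain ⟨b, hb, hxb⟩ := (h.and (Ioo_mem_nhdsGT h1)).exists
            exact absurd (hglb.1 hb) (not_le.2 hxb.2)
          · obtain ⟨c, hc, hct⟩ := (isGLB_lt_iff hglb).1 h1
            obtain ⟨b, hb, hxb⟩ := (h.and self_mem_nhdsWithin).exists
            exact hx (hoc.out hc hb ⟨hct.le, le_of_lt hxb⟩)
        simp [hx, hxa, this]
    refine ⟨{a}, fun T hT => ?_⟩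
    have ha : a ∈ T := hT (by simp)
    simp [hj, hb, ha]
  · have hlow : ∀ x, ∃ y ∈ I, y < x := not_bddBelow_iff.1 hbdd
    have hb : valueAtBot I = 1 := by
      have : ∀ᶠ t in atBot, t ∈ I := by
        obtain ⟨b, hb⟩ := hne
        filter_upwards [Iic_mem_atBot b] with t ht
        obtain ⟨c, hc, hct⟩ := hlow t
        exact hoc.out hc hb ⟨hct.le, ht⟩
      simp only [valueAtBot, if_pos this]
    have hj : ∀ x, rightJump I x = 0 := by
      intro x
      unfold rightJump
      by_cases hx : x ∈ I
      · simp [hx, hright x hx]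
      · have : ¬ ∀ᶠ t in 𝓝[>] x, t ∈ I := by
          intro h
          obtain ⟨b, hb, hxb⟩ := (h.and self_mem_nhdsWithin).exists
          obtain ⟨c, hc, hct⟩ := hlow x
          exact hx (hoc.out hc hb ⟨hct.le, le_of_lt hxb⟩)
        simp [hx, this]
    exact ⟨∅, fun T _ => by simp [hj, hb]⟩

-- Right jumps and the value near `-∞` depend linearly on the indicator function, so each of them
-- inherits the relation.
open Classical in
theorem sum_mul_relOpenEuler_eq_zero_real {ι : Type*} (s : Finset ι) (c : ι → ℤ) (I : ι → Set ℝ)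
    (hI : ∀ i ∈ s, IsRelOpenConvex (I i))
    (h : ∀ x, ∑ i ∈ s, c i * (if x ∈ I i then 1 else 0) = 0) :
    ∑ i ∈ s, c i * relOpenEuler (I i) = 0 := by
  choose! S hS using fun i hi => (hI i hi).exists_sum_rightJump
  -- If every membership is eventually constant along `l`, the limiting relation is the pointwise
  -- one at a single sufficiently late `t`.
  have key : ∀ (l : Filter ℝ) [l.NeBot],
      (∀ i ∈ s, (∀ᶠ t in l, t ∈ I i) ∨ ∀ᶠ t in l, t ∉ I i) →
      ∑ i ∈ s, c i * (if ∀ᶠ t in l, t ∈ I i then 1 else 0) = 0 := by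
    intro l _ hl
    have : ∀ᶠ t in l, ∀ i ∈ s, (t ∈ I i ↔ ∀ᶠ t in l, t ∈ I i) := by
      rw [Filter.eventually_all_finset]
      intro i hi
      rcases hl i hi with h1 | h1
      · filter_upwards [h1] with t ht
        simp [ht, h1]
      · filter_upwards [h1] with t ht
        refine iff_of_false ht fun h2 => ?_
        obtain ⟨t, ht1, ht2⟩ := (h1.and h2).exists
        exact ht1 ht2
    obtain ⟨t, ht⟩ := this.exists
    refine Eq.trans ?_ (h t)
    refine Finset.sum_congr rfl fun i hi => ?_
    simp only [ht i hi]
  have hright : ∀ x, ∑ i ∈ s, c i * rightJump (I i) x = 0 := by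
    intro x
    simp only [rightJump, mul_sub, Finset.sum_sub_distrib]
    rw [h x, key (𝓝[>] x) fun i hi => (hI i hi).1.ordConnected.eventually_or_nhdsGT x, sub_zero]
  have hbot : ∑ i ∈ s, c i * valueAtBot (I i) = 0 :=
    key atBot fun i hi => (hI i hi).1.ordConnected.eventually_or_atBot
  -- All `I i` must share one finite set of jump points; `exists_sum_rightJump` permits any superset
  -- of `S i`.
  calc ∑ i ∈ s, c i * relOpenEuler (I i)
      = ∑ i ∈ s, c i * (∑ x ∈ s.biUnion S, rightJump (I i) x - valueAtBot (I i)) := by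
        refine Finset.sum_congr rfl fun i hi => ?_
        rw [hS i hi _ (Finset.subset_biUnion_of_mem S hi)]
    _ = ∑ x ∈ s.biUnion S, ∑ i ∈ s, c i * rightJump (I i) x - ∑ i ∈ s, c i * valueAtBot (I i) := by
        rw [Finset.sum_comm, ← Finset.sum_sub_distrib]
        simp only [mul_sub, Finset.mul_sum]
    _ = 0 := by simp [hright, hbot]

end Line

/-! ### Euler's relation in finite dimension -/

section EulerRelation

variable {V : Type*} [AddCommGroup V] [Module ℝ V] [FiniteDimensional ℝ V]

-- Induction on the dimension of an affine subspace containing all the sets: the relation holds on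
-- each hyperplane slice `φ = t`, and these relations combine into one between the indicators of the
-- intervals `φ '' C i`.
open Classical in
theorem sum_mul_relOpenEuler_eq_zero_of_finrank {ι : Type*} (s : Finset ι) (c : ι → ℤ) (n : ℕ) :
    ∀ (W : Submodule ℝ V) (x₀ : V) (C : ι → Set V), Module.finrank ℝ W = n →
      (∀ i ∈ s, IsRelOpenConvex (C i)) → (∀ i ∈ s, ∀ y ∈ C i, y - x₀ ∈ W) →
      (∀ x, ∑ i ∈ s, c i * (if x ∈ C i then 1 else 0) = 0) →
      ∑ i ∈ s, c i * relOpenEuler (C i) = 0 := by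
  induction n with
  | zero =>
    intro W x₀ C hW hC hsub h
    refine Eq.trans ?_ (h x₀)
    refine Finset.sum_congr rfl fun i hi => ?_
    have hW0 : W = ⊥ := Submodule.finrank_eq_zero.1 hW
    have hsing : C i ⊆ {x₀} := fun y hy => by
      have := hsub i hi y hy
      rw [hW0, Submodule.mem_bot, sub_eq_zero] at this
      exact this
    rcases Set.subset_singleton_iff_eq.1 hsing with h0 | h0 <;> simp [h0]
  | succ n ih =>
    intro W x₀ C hW hC hsub h
    obtain ⟨w, hwW, hw0⟩ : ∃ w ∈ W, w ≠ 0 := by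
      refine W.exists_mem_ne_zero_of_ne_bot ?_
      rintro rfl
      simp at hW
    obtain ⟨φ, hφ⟩ : ∃ φ : V →ₗ[ℝ] ℝ, φ w ≠ 0 := by
      by_contra! hcon
      exact hw0 ((Module.forall_dual_apply_eq_zero_iff ℝ w).1 hcon)
    have hker : Module.finrank ℝ ↥(W ⊓ LinearMap.ker φ) = n := by
      have h1 : W.map φ = ⊤ := by
        rw [eq_top_iff]
        exact fun t _ => ⟨(t / φ w) • w, W.smul_mem _ hwW, by simp [hφ]⟩
      have h2 := finrank_map_add_finrank_inf_ker W φ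
      rw [h1, hW, finrank_top, Module.finrank_self] at h2
      omega
    have hslice : ∀ t, ∑ i ∈ s, c i * relOpenEuler (C i ∩ {x | φ x = t}) = 0 := by
      intro t
      -- The base point is moved along `w` into the hyperplane `φ = t`.
      refine ih (W ⊓ LinearMap.ker φ) (x₀ + ((t - φ x₀) / φ w) • w) _ hker
        (fun i hi => (hC i hi).slice φ t) ?_ ?_
      · rintro i hi y ⟨hy, hyt⟩
        simp only [Set.mem_ofPred_eq] at hyt
        refine ⟨?_, ?_⟩
        · rw [← sub_sub]
          exact W.sub_mem (hsub i hi y hy) (W.smul_mem _ hwW)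
        · simp [hyt, hφ]
      · intro x
        by_cases hx : φ x = t
        · simpa [hx] using h x
        · simp [hx]
    -- The extra factor `relOpenEuler (φ '' C i)` in the coefficients meets its copy from the line
    -- and squares to 1.
    have hline := sum_mul_relOpenEuler_eq_zero_real s
      (fun i => c i * relOpenEuler (C i) * relOpenEuler (φ '' C i)) (fun i => φ '' C i)
      (fun i hi => (hC i hi).image φ) (fun t => by
        refine Eq.trans ?_ (hslice t)
        refine Finset.sum_congr rfl fun i hi => ?_
        rw [(hC i hi).relOpenEuler_slice φ t]
        ring)
    rw [← hline]
    refine Finset.sum_congr rfl fun i _ => ?_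
    rcases (C i).eq_empty_or_nonempty with h0 | h0
    · simp [h0]
    · rw [mul_assoc (c i * _), relOpenEuler_sq (h0.image φ), mul_one]

open Classical in
/-- **Euler's relation**: the Euler characteristic respects linear relations between indicator
functions of relatively open convex sets. -/
theorem sum_mul_relOpenEuler_eq_zero {ι : Type*} (s : Finset ι) (c : ι → ℤ) (C : ι → Set V)
    (hC : ∀ i ∈ s, IsRelOpenConvex (C i))
    (h : ∀ x, ∑ i ∈ s, c i * (if x ∈ C i then 1 else 0) = 0) :
    ∑ i ∈ s, c i * relOpenEuler (C i) = 0 :=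
  sum_mul_relOpenEuler_eq_zero_of_finrank s c _ ⊤ 0 C rfl hC (fun _ _ _ _ => trivial) h

theorem sum_relOpenEuler_eq_of_partition {ι : Type*} (s : Finset ι) (C : ι → Set V) (D : Set V)
    (hC : ∀ i ∈ s, IsRelOpenConvex (C i)) (hD : IsRelOpenConvex D)
    (hsub : ∀ i ∈ s, C i ⊆ D) (hcover : ∀ x ∈ D, ∃! i, i ∈ s ∧ x ∈ C i) :
    ∑ i ∈ s, relOpenEuler (C i) = relOpenEuler D := by
  classical
  -- The index `none` carries `D` with coefficient `-1`.
  have := sum_mul_relOpenEuler_eq_zero (V := V) (Finset.insertNone s)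
    (fun o => o.elim (-1) fun _ => 1) (fun o => o.elim D C) ?_ ?_
  · simp only [Finset.sum_insertNone, Option.elim_none, Option.elim_some, one_mul] at this
    linarith
  · rintro (_ | i) hi
    · exact hD
    · exact hC i (by simpa using hi)
  · intro x
    simp only [Finset.sum_insertNone, Option.elim_none, Option.elim_some, one_mul]
    by_cases hx : x ∈ D
    · obtain ⟨i, ⟨hi, hxi⟩, huniq⟩ := hcover x hx
      rw [Finset.sum_eq_single_of_mem i hi]
      · simp [hx, hxi]
      · intro j hj hji
        exact if_neg fun hxj => hji (huniq j ⟨hj, hxj⟩)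
    · rw [Finset.sum_eq_zero]
      · simp [hx]
      · intro i hi
        exact if_neg fun hxi => hx (hsub i hi hxi)

end EulerRelation

/-! ### Faces of polytopes and their normal cones -/

section Faces

variable {E : Type*} [NormedAddCommGroup E] [InnerProductSpace ℝ E]

/-- The face of `P` on which the linear functional `⟪u, ·⟫` attains its maximum. -/
def faceIn (P : Set E) (u : E) : Set E :=
  {x ∈ P | ∀ y ∈ P, inner ℝ u y ≤ inner ℝ u x}

theorem faceIn_subset (P : Set E) (u : E) : faceIn P u ⊆ P := fun _ h => h.1

theorem faceIn_zero (P : Set E) : faceIn P 0 = P := by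
  simp [faceIn]

theorem isFace_iff [FiniteDimensional ℝ E] {P F : Set E} :
    IsFace P F ↔ F.Nonempty ∧ ∃ u, faceIn P u = F := by
  refine and_congr_right fun hF => ⟨fun h => ?_, ?_⟩
  · obtain ⟨l, hl⟩ := h hF
    refine ⟨(InnerProductSpace.toDual ℝ E).symm l, ?_⟩
    simp [faceIn, hl]
  · rintro ⟨u, rfl⟩ -
    exact ⟨InnerProductSpace.toDual ℝ E u, by simp [faceIn]⟩

theorem inner_eq_of_mem_faceIn {P : Set E} {u x y : E} (hx : x ∈ faceIn P u)
    (hy : y ∈ faceIn P u) : inner ℝ u x = inner ℝ u y :=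
  le_antisymm (hy.2 x hx.1) (hx.2 y hy.1)

theorem mem_faceIn_of_inner_le {P : Set E} {u x y : E} (hx : x ∈ faceIn P u) (hy : y ∈ P)
    (h : inner ℝ u x ≤ inner ℝ u y) : y ∈ faceIn P u :=
  ⟨hy, fun z hz => (hx.2 z hz).trans h⟩

theorem mem_vectorSpan_faceIn_orthogonal (P : Set E) (u : E) :
    u ∈ (vectorSpan ℝ (faceIn P u))ᗮ := by
  have h : vectorSpan ℝ (faceIn P u) ≤ (ℝ ∙ u)ᗮ := by
    rw [vectorSpan_def, Submodule.span_le]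
    rintro _ ⟨x, hx, y, hy, rfl⟩
    simp [Submodule.mem_orthogonal_singleton_iff_inner_right, inner_sub_right,
      inner_eq_of_mem_faceIn hx hy]
  exact Submodule.orthogonal_le h (Submodule.le_orthogonal_orthogonal _
    (Submodule.mem_span_singleton_self u))

theorem inner_eq_of_mem_vectorSpan_orthogonal {F : Set E} {w x y : E}
    (hw : w ∈ (vectorSpan ℝ F)ᗮ) (hx : x ∈ F) (hy : y ∈ F) : inner ℝ w x = inner ℝ w y := by
  have := Submodule.inner_left_of_mem_orthogonal (vsub_mem_vectorSpan ℝ hx hy) hw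
  rwa [vsub_eq_sub, inner_sub_right, sub_eq_zero] at this

theorem inner_le_of_mem_convexHull {s : Set E} {u z : E} {c : ℝ} (h : ∀ x ∈ s, inner ℝ u x ≤ c)
    (hz : z ∈ convexHull ℝ s) : inner ℝ u z ≤ c :=
  convexHull_min (t := {x | inner ℝ u x ≤ c}) h
    (convex_halfSpace_le (innerₗ E u).isLinear c) hz

open Classical in
/-- The points of `s` at which `⟪u, ·⟫` is maximal. -/
noncomputable def maxPoints (s : Finset E) (u : E) : Finset E :=
  s.filter fun x => ∀ y ∈ s, inner ℝ u y ≤ inner ℝ u x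

theorem mem_maxPoints {s : Finset E} {u x : E} :
    x ∈ maxPoints s u ↔ x ∈ s ∧ ∀ y ∈ s, inner ℝ u y ≤ inner ℝ u x := by
  simp [maxPoints]

theorem maxPoints_subset (s : Finset E) (u : E) : maxPoints s u ⊆ s := fun _ hx =>
  (mem_maxPoints.1 hx).1

theorem maxPoints_nonempty {s : Finset E} (hs : s.Nonempty) (u : E) : (maxPoints s u).Nonempty := by
  obtain ⟨x, hx, h⟩ := s.exists_max_image (fun x => inner ℝ u x) hs
  exact ⟨x, mem_maxPoints.2 ⟨hx, h⟩⟩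

theorem coe_maxPoints_subset_faceIn (s : Finset E) (u : E) :
    (maxPoints s u : Set E) ⊆ faceIn (convexHull ℝ (s : Set E)) u := fun _ hx =>
  ⟨subset_convexHull ℝ _ (mem_maxPoints.1 hx).1, fun _ hy =>
    inner_le_of_mem_convexHull (mem_maxPoints.1 hx).2 hy⟩

theorem convex_faceIn {P : Set E} (hP : Convex ℝ P) (u : E) : Convex ℝ (faceIn P u) := by
  have : faceIn P u = P ∩ ⋂ y ∈ P, {x | inner ℝ u y ≤ inner ℝ u x} := by
    ext; simp [faceIn]
  rw [this]
  exact hP.inter (convex_iInter₂ fun y _ => convex_halfSpace_ge (innerₗ E u).isLinear _)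

theorem faceIn_convexHull (s : Finset E) (u : E) :
    faceIn (convexHull ℝ (s : Set E)) u = convexHull ℝ (maxPoints s u : Set E) := by
  refine Set.Subset.antisymm ?_ (convexHull_min (coe_maxPoints_subset_faceIn s u)
    (convex_faceIn (convex_convexHull ℝ _) u))
  rintro x ⟨hx, hmax⟩
  obtain ⟨w, hw0, hw1, rfl⟩ := Finset.mem_convexHull'.1 hx
  set x := ∑ y ∈ s, w y • y with hxdef
  have hle : ∀ y ∈ s, inner ℝ u y ≤ inner ℝ u x := fun y hy =>
    hmax y (subset_convexHull ℝ _ hy)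
  -- A vanishing sum of nonnegative terms: the weights off `maxPoints s u` are zero.
  have hsum : ∑ y ∈ s, w y * (inner ℝ u x - inner ℝ u y) = 0 := by
    simp only [mul_sub, Finset.sum_sub_distrib, ← Finset.sum_mul, hw1, one_mul]
    rw [hxdef, inner_sum]
    simp only [inner_smul_right, sub_self]
  have hzero := (Finset.sum_eq_zero_iff_of_nonneg fun y hy =>
    mul_nonneg (hw0 y hy) (sub_nonneg.2 (hle y hy))).1 hsum
  have hout : ∀ y ∈ s, y ∉ maxPoints s u → w y = 0 := by
    intro y hy hyn
    refine (mul_eq_zero.1 (hzero y hy)).resolve_right fun h => hyn ?_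
    refine mem_maxPoints.2 ⟨hy, fun z hz => ?_⟩
    rw [← sub_eq_zero.1 h]
    exact hle z hz
  rw [Finset.mem_convexHull']
  refine ⟨w, fun y hy => hw0 y (maxPoints_subset s u hy), ?_, ?_⟩
  · rw [← hw1]
    exact Finset.sum_subset (maxPoints_subset s u) hout
  · rw [hxdef]
    exact Finset.sum_subset (maxPoints_subset s u) fun y hy hyn => by simp [hout y hy hyn]

theorem IsPolytope.isPolytope_faceIn {P : Set E} (hP : IsPolytope P) (u : E) : IsPolytope (faceIn P u) := by
  obtain ⟨s, hs, rfl⟩ := hP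
  exact ⟨maxPoints s u, maxPoints_nonempty hs u, faceIn_convexHull s u⟩

theorem IsPolytope.nonempty {P : Set E} (hP : IsPolytope P) : P.Nonempty := by
  obtain ⟨s, hs, rfl⟩ := hP
  exact hs.to_set.convexHull

theorem IsPolytope.isCompact {P : Set E} (hP : IsPolytope P) : IsCompact P := by
  obtain ⟨s, hs, rfl⟩ := hP
  exact s.finite_toSet.isCompact_convexHull (𝕜 := ℝ)

theorem IsPolytope.sum {ι : Type*} [Fintype ι] {P : ι → Set E} (hP : ∀ i, IsPolytope (P i)) :
    IsPolytope (∑ i, P i) := by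
  classical
  choose s hs h using hP
  refine ⟨∑ i, s i, ?_, ?_⟩
  · choose x hx using hs
    rw [← Finset.coe_nonempty, Finset.coe_sum]
    exact ⟨∑ i, x i, Set.finsetSum_mem_finsetSum _ _ _ fun i _ => hx i⟩
  · rw [Finset.coe_sum, convexHull_sum]
    simp only [← h]

theorem IsPolytope.isFace_faceIn [FiniteDimensional ℝ E] {P : Set E} (hP : IsPolytope P) (u : E) :
    IsFace P (faceIn P u) :=
  isFace_iff.2 ⟨(hP.isPolytope_faceIn u).nonempty, u, rfl⟩

theorem IsPolytope.finite_isFace [FiniteDimensional ℝ E] {P : Set E} (hP : IsPolytope P) :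
    {F | IsFace P F}.Finite := by
  obtain ⟨s, hs, rfl⟩ := hP
  refine ((s.powerset.finite_toSet).image
    fun t : Finset E => convexHull ℝ (t : Set E)).subset ?_
  rintro F hF
  obtain ⟨-, u, rfl⟩ := isFace_iff.1 hF
  exact ⟨maxPoints s u, by simpa using maxPoints_subset s u, (faceIn_convexHull s u).symm⟩

/-- Adding `ε • w` keeps the maximal points tied, since `w` is constant on the face, and for small
`ε` preserves the finitely many strict inequalities at the other points. -/
theorem IsPolytope.exists_faceIn_add_smul_eq {P : Set E} (hP : IsPolytope P) {u w : E}
    (hw : w ∈ (vectorSpan ℝ (faceIn P u))ᗮ) :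
    ∃ ε : ℝ, 0 < ε ∧ faceIn P (u + ε • w) = faceIn P u := by
  obtain ⟨s, hs, rfl⟩ := hP
  obtain ⟨x₀, hx₀⟩ := maxPoints_nonempty hs u
  have hmax := mem_maxPoints.1 hx₀
  have hev : ∀ᶠ ε : ℝ in 𝓝[>] 0, ∀ p ∈ s, p ∉ maxPoints s u →
      inner ℝ (u + ε • w) p < inner ℝ (u + ε • w) x₀ := by
    rw [Filter.eventually_all_finset]
    intro p hp
    by_cases hpm : p ∈ maxPoints s u
    · simp [hpm]
    have hlt : inner ℝ u p < inner ℝ u x₀ := by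
      refine lt_of_le_of_ne (hmax.2 p hp) fun h => hpm (mem_maxPoints.2 ⟨hp, fun y hy => ?_⟩)
      rw [h]
      exact hmax.2 y hy
    have h1 : ContinuousAt (fun ε : ℝ => inner ℝ (u + ε • w) p) 0 := by fun_prop
    have h2 : ContinuousAt (fun ε : ℝ => inner ℝ (u + ε • w) x₀) 0 := by fun_prop
    filter_upwards [(h1.eventually_lt h2 (by simpa using hlt)).filter_mono nhdsWithin_le_nhds]
      with ε hε _ using hε
  obtain ⟨ε, hε, hpos⟩ := (hev.and self_mem_nhdsWithin).exists
  refine ⟨ε, hpos, ?_⟩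
  have hconst : ∀ p ∈ maxPoints s u, inner ℝ (u + ε • w) p = inner ℝ (u + ε • w) x₀ := by
    intro p hp
    have h1 := coe_maxPoints_subset_faceIn s u hp
    have h2 := coe_maxPoints_subset_faceIn s u hx₀
    rw [inner_add_left, inner_add_left, inner_smul_left, inner_smul_left,
      inner_eq_of_mem_faceIn h1 h2, inner_eq_of_mem_vectorSpan_orthogonal hw h1 h2]
  rw [faceIn_convexHull, faceIn_convexHull]
  congr 2
  ext p
  constructor
  · intro hp
    by_contra hpn
    exact absurd (hε p (maxPoints_subset _ _ hp) hpn)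
      (not_lt.2 ((mem_maxPoints.1 hp).2 x₀ hmax.1))
  · intro hp
    refine mem_maxPoints.2 ⟨maxPoints_subset _ _ hp, fun y hy => ?_⟩
    rw [hconst p hp]
    by_cases hym : y ∈ maxPoints s u
    · exact (hconst y hym).le
    · exact (hε y hy hym).le

/-- The relatively open normal cone of a face. -/
def normalCone (P F : Set E) : Set E := {u | faceIn P u = F}

theorem convex_normalCone {P F : Set E} (hF : F.Nonempty) : Convex ℝ (normalCone P F) := by
  rw [convex_iff_forall_pos]
  intro u hu v hv a b ha hb _
  obtain ⟨x₀, hx₀⟩ := hF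
  have hu' : faceIn P u = F := hu
  have hv' : faceIn P v = F := hv
  have hxu : x₀ ∈ faceIn P u := hu' ▸ hx₀
  have hxv : x₀ ∈ faceIn P v := hv' ▸ hx₀
  have key : ∀ x, inner ℝ (a • u + b • v) x = a * inner ℝ u x + b * inner ℝ v x := by
    intro x
    simp [inner_add_left, inner_smul_left]
  change faceIn P (a • u + b • v) = F
  ext x
  constructor
  · rintro ⟨hx, hmax⟩
    rw [← hu']
    refine mem_faceIn_of_inner_le hxu hx ?_
    have h1 := hmax x₀ hxu.1
    rw [key, key] at h1
    have h2 := hxv.2 x hx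
    nlinarith
  · intro hx
    have h1 : x ∈ faceIn P u := hu' ▸ hx
    have h2 : x ∈ faceIn P v := hv' ▸ hx
    refine ⟨h1.1, fun y hy => ?_⟩
    rw [key, key]
    have h3 := h1.2 y hy
    have h4 := h2.2 y hy
    gcongr

theorem IsPolytope.exists_add_smul_mem_normalCone {P F : Set E} (hP : IsPolytope P) {u w : E}
    (hu : u ∈ normalCone P F) (hw : w ∈ (vectorSpan ℝ F)ᗮ) :
    ∃ ε : ℝ, 0 < ε ∧ u + ε • w ∈ normalCone P F := by
  have hu' : faceIn P u = F := hu
  subst hu'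
  exact hP.exists_faceIn_add_smul_eq hw

theorem IsPolytope.isRelOpenConvex_normalCone {P F : Set E} (hP : IsPolytope P)
    (hF : F.Nonempty) : IsRelOpenConvex (normalCone P F) := by
  refine ⟨convex_normalCone hF, fun u hu v hv => hP.exists_add_smul_mem_normalCone hu ?_⟩
  have h1 := mem_vectorSpan_faceIn_orthogonal P u
  have h2 := mem_vectorSpan_faceIn_orthogonal P v
  rw [show faceIn P u = F from hu] at h1
  rw [show faceIn P v = F from hv] at h2
  exact Submodule.sub_mem _ h1 h2

/-- This gives the normal cone the complementary dimension of its face. -/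
theorem IsPolytope.vectorSpan_normalCone {P : Set E} (hP : IsPolytope P) (u : E) :
    vectorSpan ℝ (normalCone P (faceIn P u)) = (vectorSpan ℝ (faceIn P u))ᗮ := by
  apply le_antisymm
  · rw [vectorSpan_def, Submodule.span_le]
    rintro _ ⟨v, hv, w, hw, rfl⟩
    have h1 := mem_vectorSpan_faceIn_orthogonal P v
    have h2 := mem_vectorSpan_faceIn_orthogonal P w
    rw [show faceIn P v = _ from hv] at h1
    rw [show faceIn P w = _ from hw] at h2
    exact Submodule.sub_mem _ h1 h2
  · intro w hw
    have hu : u ∈ normalCone P (faceIn P u) := rfl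
    obtain ⟨ε, hε, h⟩ := hP.exists_add_smul_mem_normalCone hu hw
    have h2 := vsub_mem_vectorSpan ℝ h hu
    simp only [vsub_eq_sub, add_sub_cancel_left] at h2
    exact (Submodule.smul_mem_iff _ hε.ne').1 h2

theorem IsPolytope.relOpenEuler_normalCone [FiniteDimensional ℝ E] {P : Set E} (hP : IsPolytope P)
    (u : E) : relOpenEuler (normalCone P (faceIn P u)) =
      (-1) ^ Module.finrank ℝ E * (-1) ^ setDim (faceIn P u) := by
  rw [relOpenEuler_of_nonempty (C := normalCone P (faceIn P u)) ⟨u, rfl⟩,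
    hP.vectorSpan_normalCone, setDim,
    ← Submodule.finrank_add_finrank_orthogonal (vectorSpan ℝ (faceIn P u)), pow_add,
    mul_right_comm, ← mul_pow]
  simp

end Faces

/-! ### Faces and dimensions of Minkowski sums -/

section Sums

variable {E : Type*} [NormedAddCommGroup E] [InnerProductSpace ℝ E] {ι : Type*} [Fintype ι]

/-- Exchanging the single summand `g j` for a better one would improve the sum. -/
theorem mem_faceIn_of_sum_mem_faceIn {P : ι → Set E} {u : E} {g : ι → E} (hg : ∀ i, g i ∈ P i)
    (h : ∑ i, g i ∈ faceIn (∑ i, P i) u) (j : ι) : g j ∈ faceIn (P j) u := by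
  classical
  refine ⟨hg j, fun y hy => ?_⟩
  have hmem : ∑ i, Function.update g j y i ∈ ∑ i, P i := by
    refine Set.finsetSum_mem_finsetSum _ _ _ fun i _ => ?_
    rcases eq_or_ne i j with rfl | hij
    · simpa using hy
    · simpa [hij] using hg i
  have h1 := h.2 _ hmem
  rw [Finset.sum_update_of_mem (Finset.mem_univ j), inner_add_right,
    ← Finset.add_sum_erase _ g (Finset.mem_univ j), inner_add_right, Finset.sdiff_singleton_eq_erase] at h1
  linarith

theorem faceIn_sum (P : ι → Set E) (u : E) : faceIn (∑ i, P i) u = ∑ i, faceIn (P i) u := by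
  ext x
  constructor
  · intro hx
    obtain ⟨g, hg, rfl⟩ := (Set.mem_fintype_sum _ _).1 hx.1
    exact Set.finsetSum_mem_finsetSum _ _ _ fun i _ => mem_faceIn_of_sum_mem_faceIn hg hx i
  · intro hx
    obtain ⟨g, hg, rfl⟩ := (Set.mem_fintype_sum _ _).1 hx
    refine ⟨Set.finsetSum_mem_finsetSum _ _ _ fun i _ => (hg i).1, fun y hy => ?_⟩
    obtain ⟨f, hf, rfl⟩ := (Set.mem_fintype_sum _ _).1 hy
    rw [inner_sum, inner_sum]
    exact Finset.sum_le_sum fun i _ => (hg i).2 _ (hf i)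

theorem faceIn_subset_of_faceIn_sum_subset {P : ι → Set E} (hP : ∀ i, IsPolytope (P i)) {u v : E}
    (h : faceIn (∑ i, P i) u ⊆ faceIn (∑ i, P i) v) (j : ι) :
    faceIn (P j) u ⊆ faceIn (P j) v := by
  classical
  intro x hx
  choose g hg using fun i => ((hP i).isPolytope_faceIn u).nonempty
  have hmem : ∀ i, Function.update g j x i ∈ faceIn (P i) u := by
    intro i
    rcases eq_or_ne i j with rfl | hij
    · simpa using hx
    · simpa [hij] using hg i
  have h1 : ∑ i, Function.update g j x i ∈ faceIn (∑ i, P i) u := by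
    rw [faceIn_sum]
    exact Set.finsetSum_mem_finsetSum _ _ _ fun i _ => hmem i
  simpa using mem_faceIn_of_sum_mem_faceIn (fun i => (hmem i).1) (h h1) j

theorem faceIn_eq_of_faceIn_sum_eq {P : ι → Set E} (hP : ∀ i, IsPolytope (P i)) {u v : E}
    (h : faceIn (∑ i, P i) u = faceIn (∑ i, P i) v) (j : ι) : faceIn (P j) u = faceIn (P j) v :=
  (faceIn_subset_of_faceIn_sum_subset hP h.subset j).antisymm
    (faceIn_subset_of_faceIn_sum_subset hP h.symm.subset j)

/-- The decomposition of a face of a Minkowski sum into faces of the summands is unique. -/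
theorem eq_faceIn_of_faceIn_sum_eq_sum [FiniteDimensional ℝ E] {P G : ι → Set E}
    (hP : ∀ i, IsPolytope (P i)) {v : E} (hG : ∀ i, IsFace (P i) (G i))
    (h : faceIn (∑ i, P i) v = ∑ i, G i) (j : ι) : G j = faceIn (P j) v := by
  classical
  have hsub : ∀ j, G j ⊆ faceIn (P j) v := by
    intro j x hx
    choose g hg using fun i => (hG i).1
    have hmem : ∀ i, Function.update g j x i ∈ G i := by
      intro i
      rcases eq_or_ne i j with rfl | hij
      · simpa using hx
      · simpa [hij] using hg i
    have h1 : ∑ i, Function.update g j x i ∈ faceIn (∑ i, P i) v := by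
      rw [h]
      exact Set.finsetSum_mem_finsetSum _ _ _ fun i _ => hmem i
    have hGP : ∀ i, G i ⊆ P i := fun i => by
      obtain ⟨-, u, hu⟩ := isFace_iff.1 (hG i)
      exact hu ▸ faceIn_subset _ _
    simpa using mem_faceIn_of_sum_mem_faceIn (fun i => hGP i (hmem i)) h1 j
  refine (hsub j).antisymm fun y hy => ?_
  obtain ⟨-, w, hw⟩ := isFace_iff.1 (hG j)
  -- `w` is a normal vector of `G j`. Adding to `y` the `w`-minimal points of the other faces and
  -- rewriting the sum as `∑ i, g i` with `g i ∈ G i` forces `⟪w, g j⟫ ≤ ⟪w, y⟫`, hence `y ∈ G j`.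
  have hmin : ∀ i, ∃ x ∈ faceIn (P i) v, ∀ z ∈ faceIn (P i) v, inner ℝ w x ≤ inner ℝ w z := by
    intro i
    obtain ⟨x, hx, hx'⟩ := ((hP i).isPolytope_faceIn v).isCompact.exists_isMinOn ((hP i).isPolytope_faceIn v).nonempty
      (f := fun x => inner ℝ w x) (by fun_prop)
    exact ⟨x, hx, fun z hz => hx' hz⟩
  choose m hm hmin using hmin
  have h1 : ∑ i, Function.update m j y i ∈ ∑ i, G i := by
    rw [← h, faceIn_sum]
    refine Set.finsetSum_mem_finsetSum _ _ _ fun i _ => ?_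
    rcases eq_or_ne i j with rfl | hij
    · simpa using hy
    · simpa [hij] using hm i
  obtain ⟨g, hg, hgs⟩ := (Set.mem_fintype_sum _ _).1 h1
  have h2 := congrArg (inner ℝ w) hgs
  rw [Finset.sum_update_of_mem (Finset.mem_univ j), inner_add_right,
    ← Finset.add_sum_erase _ g (Finset.mem_univ j), inner_add_right,
    Finset.sdiff_singleton_eq_erase, inner_sum, inner_sum] at h2
  have h3 : ∑ i ∈ Finset.univ.erase j, inner ℝ w (m i) ≤ ∑ i ∈ Finset.univ.erase j, inner ℝ w (g i) :=
    Finset.sum_le_sum fun i _ => hmin i _ (hsub i (hg i))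
  rw [← hw]
  refine mem_faceIn_of_inner_le (x := g j) (hw ▸ hg j) hy.1 ?_
  linarith

theorem vectorSpan_sum {S : ι → Set E} (hS : ∀ i, (S i).Nonempty) :
    vectorSpan ℝ (∑ i, S i) = ⨆ i, vectorSpan ℝ (S i) := by
  classical
  apply le_antisymm
  · rw [vectorSpan_def, Submodule.span_le]
    rintro _ ⟨x, hx, y, hy, rfl⟩
    obtain ⟨f, hf, rfl⟩ := (Set.mem_fintype_sum _ _).1 hx
    obtain ⟨g, hg, rfl⟩ := (Set.mem_fintype_sum _ _).1 hy
    simp only [vsub_eq_sub, ← Finset.sum_sub_distrib]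
    exact Submodule.sum_mem _ fun i _ =>
      Submodule.mem_iSup_of_mem i (vsub_mem_vectorSpan ℝ (hf i) (hg i))
  · refine iSup_le fun j => ?_
    rw [vectorSpan_def, Submodule.span_le]
    rintro _ ⟨x, hx, y, hy, rfl⟩
    choose g hg using hS
    have hmem : ∀ z ∈ S j, ∑ i, Function.update g j z i ∈ ∑ i, S i := by
      intro z hz
      refine Set.finsetSum_mem_finsetSum _ _ _ fun i _ => ?_
      rcases eq_or_ne i j with rfl | hij
      · simpa using hz
      · simpa [hij] using hg i
    have := vsub_mem_vectorSpan ℝ (hmem x hx) (hmem y hy)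
    rw [Finset.sum_update_of_mem (Finset.mem_univ j),
      Finset.sum_update_of_mem (Finset.mem_univ j)] at this
    simpa using this

/-- Dimensions add up exactly when the addition map from the product is injective, and injectivity
restricts to the `U i`. -/
theorem finrank_iSup_eq_sum_of_le {K W : Type*} [Field K] [AddCommGroup W] [Module K W]
    [FiniteDimensional K W] {U T : ι → Submodule K W} (hle : ∀ i, U i ≤ T i)
    (h : Module.finrank K ↥(⨆ i, T i) = ∑ i, Module.finrank K (T i)) :
    Module.finrank K ↥(⨆ i, U i) = ∑ i, Module.finrank K (U i) := by
  classical
  have hrange : ∀ T : ι → Submodule K W,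
      LinearMap.range (LinearMap.lsum K (fun i => T i) K fun i => (T i).subtype) = ⨆ i, T i := by
    intro T
    apply le_antisymm
    · rintro _ ⟨f, rfl⟩
      simp only [LinearMap.lsum_apply, LinearMap.coe_sum, Finset.sum_apply, LinearMap.comp_apply,
        LinearMap.proj_apply, Submodule.subtype_apply]
      exact Submodule.sum_mem _ fun i _ => Submodule.mem_iSup_of_mem i (f i).2
    · refine iSup_le fun i x hx => ⟨Pi.single i ⟨x, hx⟩, ?_⟩
      rw [LinearMap.lsum_piSingle]
      rfl
  have hker : LinearMap.ker (LinearMap.lsum K (fun i => T i) K fun i => (T i).subtype) = ⊥ := by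
    have := LinearMap.finrank_range_add_finrank_ker
      (LinearMap.lsum K (fun i => T i) K fun i => (T i).subtype)
    rw [hrange T, h, Module.finrank_pi_fintype] at this
    exact Submodule.finrank_eq_zero.1 (by omega)
  have hinj := LinearMap.ker_eq_bot.1 hker
  have hinj' : Function.Injective
      (LinearMap.lsum K (fun i => U i) K fun i => (U i).subtype) := by
    intro f g hfg
    have : (fun i => Submodule.inclusion (hle i) (f i)) =
        fun i => Submodule.inclusion (hle i) (g i) := by
      apply hinj
      simpa [LinearMap.lsum_apply] using hfg
    ext i
    simpa using congrArg Subtype.val (congrFun this i)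
  rw [← hrange U, LinearMap.finrank_range_of_inj hinj', Module.finrank_pi_fintype]

end Sums

/-! ### Enlarging a proper face to a facet -/

section Facets

variable {E : Type*} [NormedAddCommGroup E] [InnerProductSpace ℝ E]

/-- A face can be enlarged by rotating its normal vector towards a vector normal to it. -/
theorem IsPolytope.exists_faceIn_add_smul_ssubset {P : Set E} (hP : IsPolytope P) {u w x₀ p : E}
    (hw : w ∈ (vectorSpan ℝ (faceIn P u))ᗮ) (hx₀ : x₀ ∈ faceIn P u) (hp : p ∈ P)
    (hlt : inner ℝ w x₀ < inner ℝ w p) :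
    ∃ t : ℝ, faceIn P u ⊂ faceIn P (u + t • w) := by
  classical
  obtain ⟨s, hs, rfl⟩ := hP
  have hne : (s.filter fun q => inner ℝ w x₀ < inner ℝ w q).Nonempty := by
    by_contra hcon
    rw [Finset.not_nonempty_iff_eq_empty, Finset.filter_eq_empty_iff] at hcon
    exact absurd (inner_le_of_mem_convexHull (s := (s : Set E)) (fun x hx => not_lt.1 (hcon hx)) hp)
      (not_le.2 hlt)
  -- `q` is the first point to catch up with `x₀` as the normal vector `u + t • w` rotates; the
  -- minimal ratio is the time `t` at which this happens.
  obtain ⟨q, hq, hmin⟩ := Finset.exists_min_image _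
    (fun q => (inner ℝ u x₀ - inner ℝ u q) / (inner ℝ w q - inner ℝ w x₀)) hne
  rw [Finset.mem_filter] at hq
  set t := (inner ℝ u x₀ - inner ℝ u q) / (inner ℝ w q - inner ℝ w x₀) with ht
  have hexp : ∀ y, inner ℝ (u + t • w) y = inner ℝ u y + t * inner ℝ w y := fun y => by
    simp [inner_add_left, inner_smul_left]
  have hle : ∀ y ∈ s, inner ℝ u y ≤ inner ℝ u x₀ := fun y hy =>
    hx₀.2 y (subset_convexHull ℝ _ hy)
  have ht0 : 0 ≤ t := div_nonneg (sub_nonneg.2 (hle q hq.1)) (sub_pos.2 hq.2).le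
  have hbound : ∀ y ∈ (s : Set E), inner ℝ (u + t • w) y ≤ inner ℝ (u + t • w) x₀ := by
    intro y hy
    rw [hexp, hexp]
    by_cases hyw : inner ℝ w x₀ < inner ℝ w y
    · have h1 := hmin y (Finset.mem_filter.2 ⟨hy, hyw⟩)
      rw [le_div_iff₀ (sub_pos.2 hyw)] at h1
      linarith
    · have h1 := hle y hy
      have h2 := mul_le_mul_of_nonneg_left (not_lt.1 hyw) ht0
      linarith
  have hx₀' : x₀ ∈ faceIn (convexHull ℝ (s : Set E)) (u + t • w) :=
    ⟨hx₀.1, fun y hy => inner_le_of_mem_convexHull hbound hy⟩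
  refine ⟨t, Set.ssubset_iff_subset_ne.2 ⟨fun x hx => ?_, fun heq => ?_⟩⟩
  · refine mem_faceIn_of_inner_le hx₀' hx.1 ?_
    rw [hexp, hexp, inner_eq_of_mem_faceIn hx hx₀, inner_eq_of_mem_vectorSpan_orthogonal hw hx hx₀]
  · have hq' : q ∈ faceIn (convexHull ℝ (s : Set E)) (u + t • w) := by
      refine mem_faceIn_of_inner_le hx₀' (subset_convexHull ℝ _ hq.1) ?_
      rw [hexp, hexp]
      have h1 := div_mul_cancel₀ (inner ℝ u x₀ - inner ℝ u q) (sub_pos.2 hq.2).ne'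
      rw [← ht] at h1
      linarith
    rw [← heq] at hq'
    exact hq.2.ne (inner_eq_of_mem_vectorSpan_orthogonal hw hx₀ hq')

/-- `⟪u, ·⟫` is constant on the affine hull of its face, so any point of `P` in that hull already
lies in the face. -/
theorem IsPolytope.setDim_lt_of_ssubset [FiniteDimensional ℝ E] {P F : Set E} (hP : IsPolytope P)
    {u : E} (h : faceIn P u ⊂ F) (hF : F ⊆ P) :
    setDim (faceIn P u) < setDim F := by
  refine Submodule.finrank_lt_finrank_of_lt (lt_of_le_of_ne (vectorSpan_mono ℝ h.subset) ?_)
  intro heq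
  obtain ⟨x₀, hx₀⟩ := (hP.isPolytope_faceIn u).nonempty
  obtain ⟨q, hqF, hq⟩ := Set.exists_of_ssubset h
  have h1 := vsub_mem_vectorSpan ℝ hqF (h.subset hx₀)
  rw [← heq] at h1
  have h2 := Submodule.inner_left_of_mem_orthogonal h1 (mem_vectorSpan_faceIn_orthogonal P u)
  rw [vsub_eq_sub, inner_sub_right, sub_eq_zero] at h2
  exact hq (mem_faceIn_of_inner_le hx₀ (hF hqF) h2.ge)

variable [FiniteDimensional ℝ E]

theorem vectorSpan_eq_top_of_setDim {P : Set E} (hd : setDim P = Module.finrank ℝ E) :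
    vectorSpan ℝ P = ⊤ :=
  Submodule.eq_top_of_finrank_eq hd

theorem setDim_faceIn_lt (P : Set E) {u : E} (hu : u ≠ 0) :
    setDim (faceIn P u) < Module.finrank ℝ E := by
  have h1 := Submodule.finrank_add_finrank_orthogonal (vectorSpan ℝ (faceIn P u))
  have h2 : 0 < Module.finrank ℝ ↥(vectorSpan ℝ (faceIn P u))ᗮ := by
    rw [Module.finrank_pos_iff_exists_ne_zero]
    exact ⟨⟨u, mem_vectorSpan_faceIn_orthogonal P u⟩, by simpa [Subtype.ext_iff] using hu⟩
  unfold setDim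
  omega

theorem exists_inner_ne_of_setDim {P : Set E} (hd : setDim P = Module.finrank ℝ E) {w x₀ : E}
    (hw : w ≠ 0) : ∃ p ∈ P, inner ℝ w p ≠ inner ℝ w x₀ := by
  by_contra! hcon
  have h1 : faceIn P w = P := by
    refine (faceIn_subset P w).antisymm fun x hx => ⟨hx, fun y hy => ?_⟩
    rw [hcon x hx, hcon y hy]
  have h2 := mem_vectorSpan_faceIn_orthogonal P w
  rw [h1, vectorSpan_eq_top_of_setDim hd] at h2
  exact hw (by simpa using h2)

/-- Every proper face of a full-dimensional polytope lies in a facet. -/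
theorem IsPolytope.exists_facet_superset {P : Set E} (hP : IsPolytope P)
    (hd : setDim P = Module.finrank ℝ E) (n : ℕ) : ∀ u : E, u ≠ 0 →
      Module.finrank ℝ E ≤ setDim (faceIn P u) + 1 + n →
      ∃ v, faceIn P u ⊆ faceIn P v ∧
        setDim (faceIn P v) + 1 = setDim P := by
  induction n with
  | zero =>
    intro u hu h
    have := setDim_faceIn_lt P hu
    exact ⟨u, subset_rfl, by omega⟩
  | succ n ih =>
    intro u hu h
    by_cases hfac : setDim (faceIn P u) + 1 = setDim P
    · exact ⟨u, subset_rfl, hfac⟩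
    have hlt := setDim_faceIn_lt P hu
    -- The face has codimension at least 2. Taking `w` off the line of `u` keeps the rotated normal
    -- vector nonzero, so the larger face is still proper.
    obtain ⟨w, hw, hwu⟩ : ∃ w ∈ (vectorSpan ℝ (faceIn P u))ᗮ, w ∉ Submodule.span ℝ {u} := by
      by_contra! hcon
      have h1 := Submodule.finrank_mono (R := ℝ) (s := (vectorSpan ℝ (faceIn P u))ᗮ) hcon
      rw [finrank_span_singleton hu] at h1
      have h2 := Submodule.finrank_add_finrank_orthogonal (vectorSpan ℝ (faceIn P u))
      unfold setDim at *
      omega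
    have hw0 : w ≠ 0 := fun h0 => hwu (h0 ▸ Submodule.zero_mem _)
    obtain ⟨x₀, hx₀⟩ := (hP.isPolytope_faceIn u).nonempty
    obtain ⟨p, hp, hpw⟩ := exists_inner_ne_of_setDim hd (x₀ := x₀) hw0
    obtain ⟨t, ht⟩ : ∃ t : ℝ, faceIn P u ⊂ faceIn P (u + t • w) := by
      rcases hpw.lt_or_gt with h1 | h1
      · obtain ⟨t, ht⟩ := hP.exists_faceIn_add_smul_ssubset (Submodule.neg_mem _ hw) hx₀ hp
          (by simpa [inner_neg_left] using h1)
        exact ⟨-t, by simpa using ht⟩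
      · exact hP.exists_faceIn_add_smul_ssubset hw hx₀ hp h1
    have hne : u + t • w ≠ 0 := by
      intro h0
      rcases eq_or_ne t 0 with rfl | ht0
      · simp [hu] at h0
      · refine hwu ((Submodule.smul_mem_iff _ ht0).1 ?_)
        rw [← neg_eq_of_add_eq_zero_right h0]
        exact Submodule.neg_mem _ (Submodule.mem_span_singleton_self u)
    have hdim := hP.setDim_lt_of_ssubset ht (faceIn_subset _ _)
    obtain ⟨v, hv, hvd⟩ := ih _ hne (by omega)
    exact ⟨v, ht.subset.trans hv, hvd⟩

end Facets

/-! ### Exactness for all proper faces -/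

section GeneralPosition

variable {E : Type*} [NormedAddCommGroup E] [InnerProductSpace ℝ E] [FiniteDimensional ℝ E]

theorem setDim_sum_of_setDim {ι : Type*} [Fintype ι] [Nonempty ι] {P : ι → Set E}
    (hP : ∀ i, IsPolytope (P i)) (hd : ∀ i, setDim (P i) = Module.finrank ℝ E) :
    setDim (∑ i, P i) = Module.finrank ℝ E := by
  have : vectorSpan ℝ (∑ i, P i) = ⊤ := by
    rw [vectorSpan_sum fun i => (hP i).nonempty]
    obtain ⟨i⟩ := ‹Nonempty ι›
    exact top_unique ((vectorSpan_eq_top_of_setDim (hd i)).ge.trans (le_iSup_of_le i le_rfl))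
  rw [setDim, this, finrank_top]

/-- In relatively general position, all proper faces decompose exactly. -/
theorem RelativelyInGeneralPosition.setDim_faceIn_sum {r : ℕ} [NeZero r] {P : Fin r → Set E}
    (hgen : RelativelyInGeneralPosition P) (hP : ∀ i, IsPolytope (P i))
    (hd : ∀ i, setDim (P i) = Module.finrank ℝ E) {u : E} (hu : u ≠ 0) :
    setDim (faceIn (∑ i, P i) u) = ∑ i, setDim (faceIn (P i) u) := by
  have hsum := IsPolytope.sum hP
  obtain ⟨v, huv, hv⟩ := hsum.exists_facet_superset (setDim_sum_of_setDim hP hd)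
    (Module.finrank ℝ E) u hu (by omega)
  obtain ⟨G, ⟨hG, hFG⟩, hdim⟩ := hgen _ ⟨hsum.isFace_faceIn v, hv⟩
  have hGv : ∀ i, G i = faceIn (P i) v := eq_faceIn_of_faceIn_sum_eq_sum hP hG hFG
  simp only [hGv] at hdim
  rw [faceIn_sum] at hdim ⊢
  simp only [setDim] at hdim ⊢
  rw [vectorSpan_sum fun i => ((hP i).isPolytope_faceIn v).nonempty] at hdim
  rw [vectorSpan_sum fun i => ((hP i).isPolytope_faceIn u).nonempty]
  exact finrank_iSup_eq_sum_of_le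
    (fun i => vectorSpan_mono ℝ (faceIn_subset_of_faceIn_sum_subset hP huv i)) hdim

end GeneralPosition

/-! ### Components of a face -/

section Components

variable {E : Type*} [NormedAddCommGroup E] [InnerProductSpace ℝ E]

open Classical in
/-- The face of the summand `Q` of `P` that corresponds to the face `F` of `P`. -/
noncomputable def componentFace (P Q F : Set E) : Set E :=
  if h : ∃ u, faceIn P u = F then faceIn Q h.choose else ∅

theorem componentFace_faceIn {ι : Type*} [Fintype ι] {P : ι → Set E}
    (hP : ∀ i, IsPolytope (P i)) (u : E) (j : ι) :
    componentFace (∑ i, P i) (P j) (faceIn (∑ i, P i) u) = faceIn (P j) u := by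
  have h : ∃ v, faceIn (∑ i, P i) v = faceIn (∑ i, P i) u := ⟨u, rfl⟩
  rw [componentFace, dif_pos h]
  exact faceIn_eq_of_faceIn_sum_eq hP h.choose_spec j

end Components

/-! ### Alternating sums over faces -/

section Counting

variable {E : Type*} [NormedAddCommGroup E] [InnerProductSpace ℝ E] [FiniteDimensional ℝ E]

open Classical in
/-- The finite set of nonempty faces of `P`. -/
noncomputable def faces (P : Set E) : Finset (Set E) :=
  if h : {F | IsFace P F}.Finite then h.toFinset else ∅

theorem IsPolytope.mem_faces {P F : Set E} (hP : IsPolytope P) :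
    F ∈ faces P ↔ ∃ u, faceIn P u = F := by
  rw [faces, dif_pos hP.finite_isFace]
  simp only [Set.Finite.mem_toFinset, Set.mem_ofPred_eq]
  refine isFace_iff.trans (and_iff_right_of_imp ?_)
  rintro ⟨u, rfl⟩
  exact (hP.isPolytope_faceIn u).nonempty

theorem IsPolytope.fNumber_eq {P : Set E} (hP : IsPolytope P) (k : ℕ) :
    fNumber k P = ((faces P).filter fun F => setDim F = k).card := by
  rw [fNumber, ← Set.ncard_coe_finset]
  congr 1
  ext F
  simp [faces, dif_pos hP.finite_isFace]

theorem IsPolytope.sum_range_mul_fNumber {P : Set E} (hP : IsPolytope P) (d : ℕ) :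
    ∑ k ∈ Finset.range d, (-1 : ℤ) ^ k * k * fNumber k P =
      ∑ F ∈ faces P with setDim F < d, (-1) ^ setDim F * (setDim F : ℤ) := by
  rw [← Finset.sum_fiberwise_of_maps_to (t := Finset.range d) (g := setDim)
    fun F hF => Finset.mem_range.2 (Finset.mem_filter.1 hF).2]
  refine Finset.sum_congr rfl fun k hk => ?_
  have hk' := Finset.mem_range.1 hk
  rw [hP.fNumber_eq, Finset.filter_filter, Finset.sum_congr (g := fun _ => (-1 : ℤ) ^ k * k) rfl,
    Finset.sum_const, nsmul_eq_mul, mul_comm]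
  · congr 3
    refine Finset.filter_congr fun F _ => ⟨fun h => ⟨h ▸ hk', h⟩, fun h => h.2⟩
  · intro F hF
    rw [(Finset.mem_filter.1 hF).2.2]

variable {ι : Type*} [Fintype ι] {P : ι → Set E}

open Classical in
/-- The alternating number of the faces of a Minkowski sum that have a given component. -/
theorem sum_neg_one_pow_setDim_of_componentFace (hP : ∀ i, IsPolytope (P i)) (j : ι) (u : E) :
    ∑ F ∈ faces (∑ i, P i) with componentFace (∑ i, P i) (P j) F = faceIn (P j) u,
      (-1 : ℤ) ^ setDim F = (-1) ^ setDim (faceIn (P j) u) := by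
  have hsum := IsPolytope.sum hP
  have hrel := sum_relOpenEuler_eq_of_partition
    ((faces (∑ i, P i)).filter fun F => componentFace (∑ i, P i) (P j) F = faceIn (P j) u)
    (normalCone (∑ i, P i)) (normalCone (P j) (faceIn (P j) u)) ?_
    ((hP j).isRelOpenConvex_normalCone ((hP j).isPolytope_faceIn u).nonempty) ?_ ?_
  · rw [(hP j).relOpenEuler_normalCone, Finset.sum_congr (g := fun F =>
      (-1 : ℤ) ^ Module.finrank ℝ E * (-1) ^ setDim F) rfl, ← Finset.mul_sum] at hrel
    · exact mul_left_cancel₀ (by simp) hrel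
    · intro F hF
      obtain ⟨v, rfl⟩ := hsum.mem_faces.1 (Finset.mem_filter.1 hF).1
      exact hsum.relOpenEuler_normalCone v
  · intro F hF
    obtain ⟨v, rfl⟩ := hsum.mem_faces.1 (Finset.mem_filter.1 hF).1
    exact hsum.isRelOpenConvex_normalCone (hsum.isPolytope_faceIn v).nonempty
  · intro F hF v hv
    have h := (Finset.mem_filter.1 hF).2
    rw [← show faceIn (∑ i, P i) v = F from hv, componentFace_faceIn hP] at h
    exact h
  · intro v hv
    refine ⟨faceIn (∑ i, P i) v, ⟨Finset.mem_filter.2 ⟨hsum.mem_faces.2 ⟨v, rfl⟩, ?_⟩, rfl⟩, ?_⟩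
    · rw [componentFace_faceIn hP]
      exact hv
    · rintro F ⟨-, hF⟩
      exact hF.symm

/-- The fibres of `componentFace` have known alternating counts. Restricting to proper faces
respects the fibres: by full dimensionality, a face of the sum and its component are each proper
exactly when their common normal vector is nonzero. -/
theorem sum_mul_setDim_componentFace (hP : ∀ i, IsPolytope (P i))
    (hd : ∀ i, setDim (P i) = Module.finrank ℝ E) (j : ι) :
    ∑ F ∈ faces (∑ i, P i) with setDim F < Module.finrank ℝ E,
        (-1 : ℤ) ^ setDim F * (setDim (componentFace (∑ i, P i) (P j) F) : ℤ) =
      ∑ G ∈ faces (P j) with setDim G < Module.finrank ℝ E, (-1) ^ setDim G * (setDim G : ℤ) := by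
  classical
  have hsum := IsPolytope.sum hP
  have : Nonempty ι := ⟨j⟩
  have hproper : ∀ {Q : Set E} (v : E), setDim Q = Module.finrank ℝ E →
      (setDim (faceIn Q v) < Module.finrank ℝ E ↔ v ≠ 0) := by
    intro Q v hQ
    refine ⟨?_, setDim_faceIn_lt Q⟩
    rintro h rfl
    rw [faceIn_zero] at h
    omega
  have hdsum := setDim_sum_of_setDim hP hd
  rw [← Finset.sum_fiberwise_of_maps_to
    (t := (faces (P j)).filter fun G => setDim G < Module.finrank ℝ E)
    (g := componentFace (∑ i, P i) (P j))]
  · refine Finset.sum_congr rfl fun G hG => ?_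
    obtain ⟨hG, hGd⟩ := Finset.mem_filter.1 hG
    obtain ⟨u, rfl⟩ := (hP j).mem_faces.1 hG
    rw [← sum_neg_one_pow_setDim_of_componentFace hP j u, Finset.sum_mul, Finset.filter_filter]
    refine Finset.sum_congr (Finset.filter_congr fun F hF => ?_) fun F hF => ?_
    · refine and_iff_right_of_imp fun h => ?_
      obtain ⟨v, rfl⟩ := hsum.mem_faces.1 hF
      rw [componentFace_faceIn hP] at h
      rw [hproper v hdsum, ← hproper v (hd j), h]
      exact hGd
    · rw [(Finset.mem_filter.1 hF).2]
  · intro F hF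
    obtain ⟨hF, hFd⟩ := Finset.mem_filter.1 hF
    obtain ⟨v, rfl⟩ := hsum.mem_faces.1 hF
    rw [componentFace_faceIn hP]
    refine Finset.mem_filter.2 ⟨(hP j).mem_faces.2 ⟨v, rfl⟩, ?_⟩
    rw [hproper v (hd j), ← hproper v hdsum]
    exact hFd

theorem setDim_eq_sum_setDim_componentFace {r : ℕ} {P : Fin r → Set E}
    (hgen : RelativelyInGeneralPosition P) (hP : ∀ i, IsPolytope (P i))
    (hd : ∀ i, setDim (P i) = Module.finrank ℝ E) {F : Set E} (hF : F ∈ faces (∑ i, P i))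
    (hFd : setDim F < Module.finrank ℝ E) :
    setDim F = ∑ i, setDim (componentFace (∑ i, P i) (P i) F) := by
  obtain ⟨u, rfl⟩ := (IsPolytope.sum hP).mem_faces.1 hF
  simp only [componentFace_faceIn hP]
  -- The empty Minkowski sum is the point `{0}`, of dimension 0 whatever `d` is.
  rcases Nat.eq_zero_or_pos r with rfl | hr
  · rw [faceIn_sum, Finset.univ_eq_empty, Finset.sum_empty, Finset.sum_empty, setDim,
      ← Set.singleton_zero, vectorSpan_singleton, finrank_bot]
  · have : NeZero r := ⟨hr.ne'⟩
    have : Nonempty (Fin r) := ⟨⟨0, hr⟩⟩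
    refine hgen.setDim_faceIn_sum hP hd ?_
    rintro rfl
    rw [faceIn_zero, setDim_sum_of_setDim hP hd] at hFd
    exact hFd.false

end Counting

/-- The whole sum `P = P_1 + ⋯ + P_r` decomposes into the summands `P_i` themselves. -/
theorem theorem2 (d r : ℕ) (P : Fin r → Set (EuclideanSpace ℝ (Fin d)))
    (hpoly : ∀ i, IsPolytope (P i)) (hdim : ∀ i, setDim (P i) = d)
    (hgen : RelativelyInGeneralPosition P) :
    ∑ k ∈ Finset.range d, (-1 : ℤ) ^ k * (k : ℤ) * fDelta k (∑ i, P i) P = 0 := by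
  have hd : Module.finrank ℝ (EuclideanSpace ℝ (Fin d)) = d := finrank_euclideanSpace_fin
  have hdim' : ∀ i, setDim (P i) = Module.finrank ℝ (EuclideanSpace ℝ (Fin d)) := fun i => by
    rw [hdim i, hd]
  -- General position enters only here.
  have hsplit : ∑ F ∈ faces (∑ i, P i) with setDim F < d, (-1 : ℤ) ^ setDim F * (setDim F : ℤ) =
      ∑ j, ∑ F ∈ faces (∑ i, P i) with setDim F < d,
        (-1 : ℤ) ^ setDim F * (setDim (componentFace (∑ i, P i) (P j) F) : ℤ) := by
    rw [Finset.sum_comm]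
    refine Finset.sum_congr rfl fun F hF => ?_
    obtain ⟨hF, hFd⟩ := Finset.mem_filter.1 hF
    rw [← Finset.mul_sum, ← Nat.cast_sum,
      ← setDim_eq_sum_setDim_componentFace hgen hpoly hdim' hF (hd.symm ▸ hFd)]
  have hcomp := sum_mul_setDim_componentFace hpoly hdim'
  rw [hd] at hcomp
  simp only [fDelta, mul_sub, Finset.sum_sub_distrib, Finset.mul_sum]
  rw [Finset.sum_comm, (IsPolytope.sum hpoly).sum_range_mul_fNumber, hsplit, sub_eq_zero]
  refine Finset.sum_congr rfl fun j _ => ?_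
  rw [hcomp j, (hpoly j).sum_range_mul_fNumber]
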